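/- Let $p$ be an odd prime and let $r\ge 1$ be an integer. For $\alpha\in\mathbb{Z}_p$ with $p$-adic expansion $\alpha=\sum_{i\ge 0}t_i(\alpha)p^i$, $t_i(\alpha)\in\{0,1,\dots,p-1\}$, put $s_n(\alpha)=\sum_{i=0}^{n}t_i(\alpha)p^i$ for $n\ge 0$, so that $p^{-n-1}s_n(\alpha)\in[0,1)$. Let $\beta_1,\dots,\beta_r\in\mathbb{Z}_p$ be linearly independent over $\mathbb{Q}$ (as elements of $\mathbb{Q}_p$). Let $G_r$ be the set of all $\alpha\in\mathbb{Z}_p$ such that the sequence $$x_n=\bigl(p^{-n-1}s_n(\alpha\beta_1),\dots,p^{-n-1}s_n(\alpha\beta_r)\bigr),\qquad n\ge 0,$$ is equidistributed in $[0,1]^r$ with respect to Lebesgue measure, that is, $$\lim_{N\to\infty}\frac1N\sum_{n=0}^{N-1}f(x_n)=\int_{[0,1]^r}f(y)\,dy\quad\text{for every continuous } f:[0,1]^r\to\mathbb{R}.$$ Then $G_r$ has full Haar measure in $\mathbb{Z}_p$: its complement is a null set for the normalized Haar measure on $\mathbb{Z}_p$. -/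

import Mathlib

open MeasureTheory Filter Topology

/-- The Borel σ-algebra on `ℤ_p`. -/
noncomputable instance PadicInt.instMeasurableSpaceBorel (p : ℕ) [Fact p.Prime] : MeasurableSpace ℤ_[p] :=
  borel ℤ_[p]

instance PadicInt.instBorelSpaceBorel (p : ℕ) [Fact p.Prime] : BorelSpace ℤ_[p] :=
  ⟨rfl⟩

/-- The Haar measure on the compact group `(ℤ_p, +)`, normalized to have total mass `1`. -/
noncomputable def PadicInt.haar (p : ℕ) [Fact p.Prime] : Measure ℤ_[p] :=
  Measure.addHaarMeasure (⊤ : TopologicalSpace.PositiveCompacts ℤ_[p])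

instance PadicInt.isAddHaarMeasure_haar (p : ℕ) [Fact p.Prime] :
    (PadicInt.haar p).IsAddHaarMeasure :=
  Measure.isAddHaarMeasure_addHaarMeasure _

instance PadicInt.isProbabilityMeasure_haar (p : ℕ) [Fact p.Prime] :
    IsProbabilityMeasure (PadicInt.haar p) :=
  ⟨by
    have h := Measure.addHaarMeasure_self
      (K₀ := (⊤ : TopologicalSpace.PositiveCompacts ℤ_[p]))
    simpa [PadicInt.haar] using h⟩

/-- The `n`-th digit `t_n(α)` of the `p`-adic expansion `α = ∑ t_n(α) p ^ n`. Here
`α.appr (n + 1)` is the natural number below `p ^ (n + 1)` that is congruent to `α` modulo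
`p ^ (n + 1)`, and `t_n(α)` is its leading base-`p` digit. The lemmas below show that these
are the digits in the usual sense. -/
noncomputable def PadicInt.digit {p : ℕ} [Fact p.Prime] (α : ℤ_[p]) (n : ℕ) : ℕ :=
  α.appr (n + 1) / p ^ n

/-- The partial sum `s_n(α) = t_0(α) + t_1(α) p + ⋯ + t_n(α) p ^ n`
(it contains the term of index `n`). -/
noncomputable def PadicInt.partialSum {p : ℕ} [Fact p.Prime] (n : ℕ) (α : ℤ_[p]) : ℕ :=
  ∑ i ∈ Finset.range (n + 1), α.digit i * p ^ i

theorem PadicInt.digit_lt {p : ℕ} [Fact p.Prime] (α : ℤ_[p]) (n : ℕ) : α.digit n < p := by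
  have h := PadicInt.appr_lt α (n + 1)
  rw [PadicInt.digit, Nat.div_lt_iff_lt_mul (pow_pos (Fact.out : p.Prime).pos n)]
  rwa [pow_succ, mul_comm] at h

theorem PadicInt.digit_mul_pow {p : ℕ} [Fact p.Prime] (α : ℤ_[p]) (n : ℕ) :
    α.digit n * p ^ n + α.appr n = α.appr (n + 1) := by
  obtain ⟨c, hc⟩ := PadicInt.dvd_appr_sub_appr α n (n + 1) (Nat.le_succ n)
  have hle : α.appr n ≤ α.appr (n + 1) := PadicInt.appr_mono α (Nat.le_succ n)
  have hlt := PadicInt.appr_lt α n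
  have he : α.appr (n + 1) = α.appr n + p ^ n * c := by omega
  rw [PadicInt.digit, he, Nat.add_mul_div_left _ _ (pow_pos (Fact.out : p.Prime).pos n),
    Nat.div_eq_of_lt hlt]
  ring

theorem PadicInt.partialSum_eq_appr {p : ℕ} [Fact p.Prime] (n : ℕ) (α : ℤ_[p]) :
    PadicInt.partialSum n α = α.appr (n + 1) := by
  induction n with
  | zero =>
    have h := PadicInt.digit_mul_pow α 0
    simpa [PadicInt.partialSum, PadicInt.appr] using h
  | succ n ih =>
    have h := PadicInt.digit_mul_pow α (n + 1)
    rw [PadicInt.partialSum, Finset.sum_range_succ, ← h, ← ih, PadicInt.partialSum, add_comm]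

theorem PadicInt.partialSum_lt {p : ℕ} [Fact p.Prime] (n : ℕ) (α : ℤ_[p]) :
    PadicInt.partialSum n α < p ^ (n + 1) := by
  rw [PadicInt.partialSum_eq_appr]
  exact PadicInt.appr_lt α (n + 1)

/-- The digits are those of the `p`-adic expansion: `α = ∑ t_n(α) p ^ n` in `ℤ_p`. -/
theorem PadicInt.tendsto_partialSum {p : ℕ} [Fact p.Prime] (α : ℤ_[p]) :
    Tendsto (fun n => (PadicInt.partialSum n α : ℤ_[p])) atTop (𝓝 α) := by
  have hp : (1 : ℝ) < p := by exact_mod_cast (Fact.out : p.Prime).one_lt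
  have hz : Tendsto (fun n : ℕ => ((p : ℝ)⁻¹) ^ (n + 1)) atTop (𝓝 0) :=
    (tendsto_pow_atTop_nhds_zero_of_lt_one (by positivity) (inv_lt_one_of_one_lt₀ hp)).comp
      (tendsto_add_atTop_nat 1)
  rw [tendsto_iff_norm_sub_tendsto_zero]
  refine squeeze_zero (fun _ => norm_nonneg _) (fun n => ?_) hz
  rw [norm_sub_rev, PadicInt.partialSum_eq_appr]
  have h := (PadicInt.norm_le_pow_iff_mem_span_pow _ (n + 1)).2 (PadicInt.appr_spec (n + 1) α)
  refine h.trans (le_of_eq ?_)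
  rw [zpow_neg, zpow_natCast, inv_pow]

/-- The point `p ^ (-n-1) s_n(α)` of `[0,1]`. -/
noncomputable def PadicInt.scaledPartialSum {p : ℕ} [Fact p.Prime] (n : ℕ) (α : ℤ_[p]) :
    unitInterval :=
  ⟨(PadicInt.partialSum n α : ℝ) / (p : ℝ) ^ (n + 1), by
    have hp : (0 : ℝ) < (p : ℝ) ^ (n + 1) :=
      pow_pos (by exact_mod_cast (Fact.out : p.Prime).pos) _
    refine ⟨by positivity, (div_le_one hp).2 ?_⟩
    exact_mod_cast (PadicInt.partialSum_lt n α).le⟩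

/-- A sequence `x` in a compact space `X` is equidistributed with respect to a Borel measure `ν`
if `(1/N) ∑_{n < N} f (x n) → ∫ f dν` for every continuous `f : X → ℝ`. -/
def IsEquidistributed {X : Type*} [TopologicalSpace X] [CompactSpace X] [MeasurableSpace X]
    (ν : Measure X) (x : ℕ → X) : Prop :=
  ∀ f : C(X, ℝ), Tendsto (fun N : ℕ => (∑ n ∈ Finset.range N, f (x n)) / (N : ℝ)) atTop
    (𝓝 (∫ y, f y ∂ν))

/-- The set `G_r` of those `α ∈ ℤ_p` for which the sequence
`(p ^ (-n-1) s_n(α β_1), …, p ^ (-n-1) s_n(α β_r))`, `n ≥ 0`, is equidistributed in `[0,1]^r`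
with respect to Lebesgue measure, which is the `volume` of the cube `Fin r → unitInterval`. -/
def equidistributedSet {p : ℕ} [Fact p.Prime] {r : ℕ} (β : Fin r → ℤ_[p]) : Set ℤ_[p] :=
  {α | IsEquidistributed (volume : Measure (Fin r → unitInterval))
    (fun n i => PadicInt.scaledPartialSum n (α * β i))}

/-! By Weyl's criterion it suffices that, for almost every α and each nonzero k ∈ ℤ^r, the averages
of exp(2πi k·x_n) tend to 0. Since s_n(α) ≡ α mod p^(n+1), this exponential is `levelChar p (n + 1)
(α * γ)` with γ = ∑ k_i β_i, and γ ≠ 0 by linear independence. Once n is at least the valuation of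
γ, these functions of α are pairwise orthogonal (`integral_levelChar_mul_conj_eq_zero`): some
translation of α multiplies the higher one by a root of unity ≠ 1 and fixes the lower one.

Orthogonality bounds the second moment of a sum of N terms by N. Averages along the squares M² then
have summable second moments, hence converge to 0 almost everywhere, and boundedness fills the gaps
(`ae_tendsto_average_of_orthogonal`). Countably many k cost only a null set.

Test functions on the closed cube need not be periodic, so `isEquidistributed_of_mFourier` cuts them
off near the boundary and controls the error by the averages of a periodic function. -/

/-! ### Averages of bounded sequences and a strong law for orthogonal functions. -/

/-- If the averages of a sequence bounded by `1` tend to `0` along the squares, they tend to `0`. -/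
theorem tendsto_average_of_tendsto_average_sq {a : ℕ → ℂ} (ha : ∀ n, ‖a n‖ ≤ 1)
    (h : Tendsto (fun M : ℕ => (∑ n ∈ Finset.range (M ^ 2), a n) / ((M ^ 2 : ℕ) : ℂ)) atTop (𝓝 0)) :
    Tendsto (fun N : ℕ => (∑ n ∈ Finset.range N, a n) / (N : ℂ)) atTop (𝓝 0) := by
  have hs : Tendsto Nat.sqrt atTop atTop := by
    refine tendsto_atTop.2 fun b => ?_
    filter_upwards [eventually_ge_atTop (b * b)] with n hn
    exact Nat.le_sqrt.2 hn
  have h1 := (tendsto_zero_iff_norm_tendsto_zero.1 h).comp hs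
  -- With M = `Nat.sqrt N`, at most 2M indices lie between M² and N; divided by M² they contribute 2
  -- / M.
  have h2 : Tendsto (fun N : ℕ => 2 / (Nat.sqrt N : ℝ)) atTop (𝓝 0) :=
    (tendsto_const_div_atTop_nhds_zero_nat 2).comp hs
  have h3 := h1.add h2
  rw [add_zero] at h3
  refine squeeze_zero_norm' ?_ h3
  filter_upwards [eventually_gt_atTop 0] with N hN
  set M := Nat.sqrt N with hM
  have hMpos : 0 < M := Nat.sqrt_pos.2 hN
  have hle : M ^ 2 ≤ N := Nat.sqrt_le' N
  have hub : N - M ^ 2 ≤ 2 * M := by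
    have := Nat.sqrt_le_add N
    rw [← hM] at this
    have e : M ^ 2 = M * M := sq M
    omega
  have hMr : (0 : ℝ) < M := by exact_mod_cast hMpos
  have hNr : (0 : ℝ) < N := by exact_mod_cast hN
  have hler : (M : ℝ) ^ 2 ≤ N := by exact_mod_cast hle
  have hsplit : ∑ n ∈ Finset.range N, a n
      = ∑ n ∈ Finset.range (M ^ 2), a n + ∑ n ∈ Finset.Ico (M ^ 2) N, a n :=
    (Finset.sum_range_add_sum_Ico _ hle).symm
  have hrest : ‖∑ n ∈ Finset.Ico (M ^ 2) N, a n‖ ≤ 2 * M := by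
    calc _ ≤ ∑ n ∈ Finset.Ico (M ^ 2) N, (1 : ℝ) := norm_sum_le_of_le _ fun n _ => ha n
      _ = ((N - M ^ 2 : ℕ) : ℝ) := by simp
      _ ≤ 2 * M := by exact_mod_cast hub
  simp only [Function.comp, norm_div, Complex.norm_natCast, ← hM]
  rw [hsplit]
  calc _ ≤ (‖∑ n ∈ Finset.range (M ^ 2), a n‖ + 2 * M) / N := by
        gcongr
        exact (norm_add_le _ _).trans (by gcongr)
    _ ≤ (‖∑ n ∈ Finset.range (M ^ 2), a n‖ + 2 * M) / (M : ℝ) ^ 2 := by gcongr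
    _ = _ := by
        push_cast
        field_simp

/-- Averages of a shifted bounded sequence have the same behaviour. -/
theorem tendsto_average_of_tendsto_average_shift {a : ℕ → ℂ} (ha : ∀ n, ‖a n‖ ≤ 1) (v : ℕ)
    (h : Tendsto (fun N : ℕ => (∑ n ∈ Finset.range N, a (n + v)) / (N : ℂ)) atTop (𝓝 0)) :
    Tendsto (fun N : ℕ => (∑ n ∈ Finset.range N, a n) / (N : ℂ)) atTop (𝓝 0) := by
  have h2 : Tendsto (fun N : ℕ => (2 * v : ℝ) / (N : ℝ)) atTop (𝓝 0) :=
    tendsto_const_div_atTop_nhds_zero_nat _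
  have h3 := (tendsto_zero_iff_norm_tendsto_zero.1 h).add h2
  rw [add_zero] at h3
  refine squeeze_zero_norm (fun N => ?_) h3
  -- Both sides are the sum over `range (N + v)`.
  have e : ∑ n ∈ Finset.range N, a n + ∑ n ∈ Finset.range v, a (n + N)
      = ∑ n ∈ Finset.range v, a n + ∑ n ∈ Finset.range N, a (n + v) := by
    simp_rw [add_comm _ N, add_comm _ v, ← Finset.sum_range_add, add_comm]
  have e' : ∑ n ∈ Finset.range N, a n
      = ∑ n ∈ Finset.range N, a (n + v)
        + (∑ n ∈ Finset.range v, a n - ∑ n ∈ Finset.range v, a (n + N)) := by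
    linear_combination e
  have b1 : ‖∑ n ∈ Finset.range v, a n‖ ≤ v := by
    simpa using norm_sum_le_of_le (Finset.range v) fun n _ => ha n
  have b2 : ‖∑ n ∈ Finset.range v, a (n + N)‖ ≤ v := by
    simpa using norm_sum_le_of_le (Finset.range v) fun n _ => ha (n + N)
  rw [norm_div, norm_div, Complex.norm_natCast, ← add_div, e']
  gcongr
  refine (norm_add_le _ _).trans ?_
  gcongr
  linarith [norm_sub_le (∑ n ∈ Finset.range v, a n) (∑ n ∈ Finset.range v, a (n + N))]

/-- The second moment of a sum of orthogonal functions bounded by `1`. -/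
theorem integral_normSq_sum_le_of_orthogonal {Ω : Type*} [MeasurableSpace Ω] {μ : Measure Ω}
    [IsProbabilityMeasure μ] {f : ℕ → Ω → ℂ} (hf : ∀ n, Measurable (f n))
    (hb : ∀ n ω, ‖f n ω‖ ≤ 1)
    (ho : ∀ m n, n < m → ∫ ω, f m ω * (starRingEnd ℂ) (f n ω) ∂μ = 0) (N : ℕ) :
    ∫ ω, ‖∑ n ∈ Finset.range N, f n ω‖ ^ 2 ∂μ ≤ N := by
  have hm : ∀ g : Ω → ℂ, ∀ C : ℝ, Measurable g → (∀ ω, ‖g ω‖ ≤ C) → Integrable g μ :=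
    fun g C hg hC => Integrable.of_bound hg.aestronglyMeasurable C (ae_of_all _ hC)
  have hmR : ∀ g : Ω → ℝ, ∀ C : ℝ, Measurable g → (∀ ω, ‖g ω‖ ≤ C) → Integrable g μ :=
    fun g C hg hC => Integrable.of_bound hg.aestronglyMeasurable C (ae_of_all _ hC)
  induction N with
  | zero => simp
  | succ N ih =>
    have hS : ∀ ω, ‖∑ n ∈ Finset.range N, f n ω‖ ≤ N := fun ω => by
      simpa using norm_sum_le_of_le (Finset.range N) fun n _ => hb n ω
    have hSm : Measurable fun ω => ∑ n ∈ Finset.range N, f n ω :=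
      Finset.measurable_sum _ fun n _ => hf n
    have hcm : Measurable (starRingEnd ℂ) := Complex.continuous_conj.measurable
    have hI1 : Integrable (fun ω => ‖∑ n ∈ Finset.range N, f n ω‖ ^ 2) μ := by
      refine hmR _ (N ^ 2) (hSm.norm.pow_const 2) fun ω => ?_
      rw [Real.norm_of_nonneg (by positivity)]
      gcongr
      exact hS ω
    have hI2 : Integrable (fun ω => f N ω * (starRingEnd ℂ) (∑ n ∈ Finset.range N, f n ω)) μ := by
      refine hm _ (1 * N) ((hf N).mul (hcm.comp hSm)) fun ω => ?_
      rw [norm_mul, RCLike.norm_conj]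
      exact mul_le_mul (hb N ω) (hS ω) (norm_nonneg _) zero_le_one
    have hI3 : Integrable (fun ω => ‖f N ω‖ ^ 2) μ := by
      refine hmR _ 1 ((hf N).norm.pow_const 2) fun ω => ?_
      rw [Real.norm_of_nonneg (by positivity)]
      exact pow_le_one₀ (norm_nonneg _) (hb N ω)
    have hz : ∫ ω, f N ω * (starRingEnd ℂ) (∑ n ∈ Finset.range N, f n ω) ∂μ = 0 := by
      simp_rw [map_sum, Finset.mul_sum]
      rw [integral_finsetSum]
      · exact Finset.sum_eq_zero fun n hn => ho N n (Finset.mem_range.1 hn)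
      · intro n _
        refine hm _ (1 * 1) ((hf N).mul (hcm.comp (hf n))) fun ω => ?_
        rw [norm_mul, RCLike.norm_conj]
        exact mul_le_mul (hb N ω) (hb n ω) (norm_nonneg _) zero_le_one
    have hexp : ∀ ω, ‖∑ n ∈ Finset.range (N + 1), f n ω‖ ^ 2
        = ‖∑ n ∈ Finset.range N, f n ω‖ ^ 2
          + (2 * (f N ω * (starRingEnd ℂ) (∑ n ∈ Finset.range N, f n ω)).re + ‖f N ω‖ ^ 2) := by
      intro ω
      rw [Finset.sum_range_succ, add_comm, Complex.sq_norm, Complex.sq_norm, Complex.sq_norm,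
        Complex.normSq_add]
      ring
    have hre : ∫ ω, (f N ω * (starRingEnd ℂ) (∑ n ∈ Finset.range N, f n ω)).re ∂μ = 0 := by
      have := integral_re hI2
      simp only [RCLike.re_to_complex] at this
      rw [this, hz, Complex.zero_re]
    have h3 : ∫ ω, ‖f N ω‖ ^ 2 ∂μ ≤ 1 := by
      calc _ ≤ ∫ _, (1 : ℝ) ∂μ := integral_mono hI3 (integrable_const _) fun ω =>
            pow_le_one₀ (norm_nonneg _) (hb N ω)
        _ = 1 := by simp
    have hI2' : Integrable
        (fun ω => 2 * (f N ω * (starRingEnd ℂ) (∑ n ∈ Finset.range N, f n ω)).re) μ :=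
      hI2.re.const_mul 2
    simp_rw [hexp]
    have e1 := integral_add hI1 (hI2'.add hI3)
    simp only [Pi.add_apply] at e1
    rw [e1, integral_add hI2' hI3, integral_const_mul, hre]
    push_cast
    linarith

/-- A strong law of large numbers for bounded orthogonal functions. -/
theorem ae_tendsto_average_of_orthogonal {Ω : Type*} [MeasurableSpace Ω] {μ : Measure Ω}
    [IsProbabilityMeasure μ] {f : ℕ → Ω → ℂ} (hf : ∀ n, Measurable (f n))
    (hb : ∀ n ω, ‖f n ω‖ ≤ 1)
    (ho : ∀ m n, n < m → ∫ ω, f m ω * (starRingEnd ℂ) (f n ω) ∂μ = 0) :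
    ∀ᵐ ω ∂μ, Tendsto (fun N : ℕ => (∑ n ∈ Finset.range N, f n ω) / (N : ℂ)) atTop (𝓝 0) := by
  set g : ℕ → Ω → ℝ := fun M ω =>
    ‖(∑ n ∈ Finset.range (M ^ 2), f n ω) / ((M ^ 2 : ℕ) : ℂ)‖ ^ 2 with hg
  have hgm : ∀ M, Measurable (g M) := fun M =>
    ((Finset.measurable_sum _ fun n _ => hf n).div_const _).norm.pow_const 2
  have hg0 : ∀ M ω, 0 ≤ g M ω := fun M ω => by positivity
  have hgi : ∀ M, Integrable (g M) μ := by
    intro M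
    refine Integrable.of_bound (hgm M).aestronglyMeasurable 1 (ae_of_all _ fun ω => ?_)
    rw [Real.norm_of_nonneg (hg0 M ω)]
    refine pow_le_one₀ (norm_nonneg _) ?_
    rw [norm_div, Complex.norm_natCast]
    refine div_le_one_of_le₀ ?_ (by positivity)
    exact (norm_sum_le_of_le (Finset.range (M ^ 2)) fun n _ => hb n ω).trans (by simp)
  have hgI : ∀ M : ℕ, ∫ ω, g M ω ∂μ ≤ 1 / (M : ℝ) ^ 2 := by
    intro M
    simp only [hg, norm_div, Complex.norm_natCast, div_pow]
    rw [integral_div]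
    rcases Nat.eq_zero_or_pos M with rfl | hM
    · simp
    have hMr : (0 : ℝ) < M := by exact_mod_cast hM
    have := integral_normSq_sum_le_of_orthogonal hf hb ho (M ^ 2)
    calc _ ≤ ((M ^ 2 : ℕ) : ℝ) / ((M ^ 2 : ℕ) : ℝ) ^ 2 := by gcongr
      _ = _ := by push_cast; field_simp
  -- The integral of ∑ `g M` is finite, so the series converges almost everywhere and its terms tend
  -- to 0 there.
  have hfin : ∫⁻ ω, ∑' M, ENNReal.ofReal (g M ω) ∂μ ≠ ⊤ := by
    rw [lintegral_tsum fun M => (hgm M).ennreal_ofReal.aemeasurable]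
    have hs : Summable fun M : ℕ => 1 / (M : ℝ) ^ 2 :=
      Real.summable_one_div_nat_pow.2 one_lt_two
    refine ne_top_of_le_ne_top hs.tsum_ofReal_ne_top (ENNReal.tsum_le_tsum fun M => ?_)
    rw [← ofReal_integral_eq_lintegral_ofReal (hgi M) (ae_of_all _ (hg0 M))]
    exact ENNReal.ofReal_le_ofReal (hgI M)
  have hae := ae_lt_top (Measurable.tsum fun M => (hgm M).ennreal_ofReal) hfin
  filter_upwards [hae] with ω hω
  refine tendsto_average_of_tendsto_average_sq (fun n => hb n ω) ?_
  have h1 : Tendsto (fun M => g M ω) atTop (𝓝 0) := by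
    have h := (ENNReal.tendsto_toReal ENNReal.zero_ne_top).comp
      (ENNReal.tendsto_atTop_zero_of_tsum_ne_top hω.ne)
    refine (h.congr fun M => ?_)
    exact ENNReal.toReal_ofReal (hg0 M ω)
  have h2 := (Real.continuous_sqrt.tendsto 0).comp h1
  rw [Real.sqrt_zero] at h2
  refine tendsto_zero_iff_norm_tendsto_zero.2 (h2.congr fun M => ?_)
  exact Real.sqrt_sq (norm_nonneg _)

/-! ### Characters of ℤ_p and their orthogonality. -/

namespace PadicInt

variable {p : ℕ} [Fact p.Prime]

/-- The additive character `x ↦ exp (2πi x / p ^ n)` of `ℤ_p`. -/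
noncomputable def levelChar (p : ℕ) [Fact p.Prime] (n : ℕ) : AddChar ℤ_[p] ℂ :=
  (ZMod.stdAddChar (N := p ^ n)).compAddMonoidHom (toZModPow n : ℤ_[p] →+* ZMod (p ^ n))

theorem levelChar_apply (n : ℕ) (x : ℤ_[p]) :
    levelChar p n x = ZMod.stdAddChar (toZModPow n x) := rfl

theorem norm_levelChar (n : ℕ) (x : ℤ_[p]) : ‖levelChar p n x‖ = 1 := by
  rw [levelChar_apply, ZMod.stdAddChar_apply, Circle.norm_coe]

theorem toZModPow_eq_zero_of_dvd {n : ℕ} {x : ℤ_[p]} (h : (p : ℤ_[p]) ^ n ∣ x) :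
    toZModPow n x = 0 := by
  rw [← RingHom.mem_ker, ker_toZModPow]
  exact Ideal.mem_span_singleton.2 h

theorem levelChar_eq_one_of_dvd {n : ℕ} {x : ℤ_[p]} (h : (p : ℤ_[p]) ^ n ∣ x) :
    levelChar p n x = 1 := by
  rw [levelChar_apply, toZModPow_eq_zero_of_dvd h, AddChar.map_zero_eq_one]

/-- The standard character is injective and p^n is nonzero modulo p^(n+1). This value is the
multiplier in the orthogonality argument. -/
theorem levelChar_succ_pow_ne_one (n : ℕ) : levelChar p (n + 1) ((p : ℤ_[p]) ^ n) ≠ 1 := by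
  have hp : p.Prime := Fact.out
  rw [levelChar_apply, map_pow, map_natCast, ← AddChar.map_zero_eq_one (ZMod.stdAddChar (N := p ^ (n + 1)))]
  intro h
  have h0 := ZMod.injective_stdAddChar h
  rw [← Nat.cast_pow, ZMod.natCast_eq_zero_iff] at h0
  exact absurd ((Nat.pow_dvd_pow_iff_le_right hp.one_lt).1 h0) (by omega)

theorem continuous_toZModPow (n : ℕ) :
    Continuous (toZModPow n : ℤ_[p] → ZMod (p ^ n)) := by
  have : IsLocallyConstant (toZModPow n : ℤ_[p] → ZMod (p ^ n)) := by
    refine (IsLocallyConstant.iff_eventually_eq _).2 fun x => ?_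
    have hp : (0 : ℝ) < (p : ℝ) ^ (-n : ℤ) :=
      zpow_pos (by exact_mod_cast (Fact.out : p.Prime).pos) _
    filter_upwards [Metric.ball_mem_nhds x hp] with y hy
    rw [Metric.mem_ball, dist_eq_norm] at hy
    rw [← sub_eq_zero, ← map_sub]
    exact toZModPow_eq_zero_of_dvd
      (Ideal.mem_span_singleton.1 ((norm_le_pow_iff_mem_span_pow _ n).1 hy.le))
  exact this.continuous

theorem continuous_levelChar (n : ℕ) : Continuous (levelChar p n) :=
  (continuous_of_discreteTopology (f := ZMod.stdAddChar (N := p ^ n))).comp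
    (continuous_toZModPow n)

/-- The characters `α ↦ exp (2πi α γ / p ^ n)` with `n` above the valuation of `γ` are
orthogonal. -/
theorem integral_levelChar_mul_conj_eq_zero {γ : ℤ_[p]} (hγ : γ ≠ 0) {m n : ℕ}
    (hm : γ.valuation ≤ m) (hn : n ≤ m) :
    ∫ α, levelChar p (m + 1) (α * γ) * (starRingEnd ℂ) (levelChar p n (α * γ)) ∂(haar p) = 0 := by
  set h : ℤ_[p] → ℂ := fun α =>
    levelChar p (m + 1) (α * γ) * (starRingEnd ℂ) (levelChar p n (α * γ)) with hh
  -- Write γ = u p^v with u a unit and take a = u⁻¹ p^(m-v), which needs v ≤ m.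
  obtain ⟨a, ha⟩ : ∃ a, a * γ = (p : ℤ_[p]) ^ m := by
    refine ⟨(p : ℤ_[p]) ^ (m - γ.valuation) * ((unitCoeff hγ)⁻¹ : ℤ_[p]ˣ), ?_⟩
    calc _ = (p : ℤ_[p]) ^ (m - γ.valuation) * ((unitCoeff hγ)⁻¹ : ℤ_[p]ˣ)
          * (unitCoeff hγ * (p : ℤ_[p]) ^ γ.valuation) := by rw [← unitCoeff_spec hγ]
      _ = (p : ℤ_[p]) ^ (m - γ.valuation) * (p : ℤ_[p]) ^ γ.valuation
          * (((unitCoeff hγ)⁻¹ : ℤ_[p]ˣ) * (unitCoeff hγ : ℤ_[p])) := by ring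
      _ = _ := by rw [Units.inv_mul, mul_one, ← pow_add, Nat.sub_add_cancel hm]
  -- The conjugated factor does not change, since p^n divides aγ = p^m.
  have key : ∀ α, h (α + a) = levelChar p (m + 1) ((p : ℤ_[p]) ^ m) * h α := by
    intro α
    simp only [hh, add_mul, ha, AddChar.map_add_eq_mul, map_mul,
      levelChar_eq_one_of_dvd (pow_dvd_pow (p : ℤ_[p]) hn), map_one]
    ring
  -- Translation invariance gives I = ζ I with ζ ≠ 1, hence I = 0.
  have hint : ∫ α, h α ∂(haar p)
      = levelChar p (m + 1) ((p : ℤ_[p]) ^ m) * ∫ α, h α ∂(haar p) := by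
    rw [← integral_const_mul, ← integral_add_right_eq_self h a]
    simp_rw [key]
  have := sub_eq_zero.2 hint
  rw [← one_sub_mul, mul_eq_zero, sub_eq_zero] at this
  exact this.resolve_left (levelChar_succ_pow_ne_one m).symm

end PadicInt

/-! ### The cube as a cover of the torus. -/

/-- The projection of the unit cube onto the torus. -/
noncomputable def cubeToTorus (d : Type*) : C(d → unitInterval, UnitAddTorus d) where
  toFun x i := ((x i : ℝ) : UnitAddCircle)
  continuous_toFun := by
    refine continuous_pi fun i => ?_
    exact (AddCircle.continuous_mk' 1).comp (continuous_subtype_val.comp (continuous_apply i))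

theorem cubeToTorus_apply {d : Type*} (x : d → unitInterval) (i : d) :
    cubeToTorus d x i = ((x i : ℝ) : UnitAddCircle) := rfl

theorem surjective_cubeToTorus (d : Type*) : Function.Surjective (cubeToTorus d) := by
  intro t
  have h : ∀ i, ∃ y : unitInterval, ((y : ℝ) : UnitAddCircle) = t i := by
    intro i
    have hy : t i ∈ ((↑) : ℝ → UnitAddCircle) '' Set.Icc 0 (0 + 1) := by
      rw [AddCircle.coe_image_Icc_eq]
      trivial
    obtain ⟨y, hy, e⟩ := hy
    exact ⟨⟨y, by simpa using hy⟩, e⟩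
  choose y hy using h
  exact ⟨y, funext hy⟩

/-- A continuous map from a compact space to a Hausdorff space is closed. It lets functions
respecting the gluing descend to the torus. -/
theorem isQuotientMap_cubeToTorus (d : Type*) : IsQuotientMap (cubeToTorus d) :=
  (cubeToTorus d).continuous.isClosedMap.isQuotientMap (cubeToTorus d).continuous
    (surjective_cubeToTorus d)

/-- Only the endpoints are glued; being an endpoint is written as the vanishing of a factor of
`boundaryFun`. -/
theorem unitInterval.eq_or_of_coe_unitAddCircle_eq {x y : unitInterval}
    (h : ((x : ℝ) : UnitAddCircle) = ((y : ℝ) : UnitAddCircle)) :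
    x = y ∨ ((x : ℝ) * (1 - x) = 0 ∧ (y : ℝ) * (1 - y) = 0) := by
  have key : ∀ z : unitInterval, ((z : ℝ) : UnitAddCircle) = 0 → (z : ℝ) = 1 ∨ (z : ℝ) = 0 := by
    intro z hz
    rcases z.2.2.eq_or_lt with h1 | h1
    · exact Or.inl h1
    · right
      refine (AddCircle.coe_eq_coe_iff_of_mem_Ico (p := (1 : ℝ)) (a := 0) ?_ ?_).1 ?_
      · exact ⟨z.2.1, by simpa using h1⟩
      · exact ⟨le_rfl, by norm_num⟩
      · simpa using hz
  have one : ((1 : ℝ) : UnitAddCircle) = 0 := AddCircle.coe_period 1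
  rcases x.2.2.eq_or_lt with hx | hx
  · right
    rw [hx, one] at h
    refine ⟨by rw [hx]; simp, ?_⟩
    rcases key y h.symm with e | e <;> simp [e]
  rcases y.2.2.eq_or_lt with hy | hy
  · right
    rw [hy, one] at h
    refine ⟨?_, by rw [hy]; simp⟩
    rcases key x h with e | e <;> simp [e]
  · left
    refine Subtype.ext ((AddCircle.coe_eq_coe_iff_of_mem_Ico (p := (1 : ℝ)) (a := 0) ?_ ?_).1 h)
    · exact ⟨x.2.1, by simpa using hx⟩
    · exact ⟨y.2.1, by simpa using hy⟩

/-! ### Cutoffs near the boundary of the cube. -/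

section Cutoff

variable {d : Type*} [Fintype d]

/-- A function on the cube that vanishes exactly on the boundary. -/
noncomputable def boundaryFun (d : Type*) [Fintype d] : C(d → unitInterval, ℝ) where
  toFun x := ∏ i, (x i : ℝ) * (1 - x i)
  continuous_toFun := by fun_prop

theorem boundaryFun_nonneg (x : d → unitInterval) : 0 ≤ boundaryFun d x :=
  Finset.prod_nonneg fun i _ => mul_nonneg (x i).2.1 (sub_nonneg.2 (x i).2.2)

/-- A continuous cutoff that vanishes on the boundary and tends to `1` in the interior. -/
noncomputable def cubeCutoff (d : Type*) [Fintype d] (m : ℕ) : C(d → unitInterval, ℝ) where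
  toFun x := min 1 (m * boundaryFun d x)
  continuous_toFun := by fun_prop

theorem cubeCutoff_apply (m : ℕ) (x : d → unitInterval) :
    cubeCutoff d m x = min 1 (m * boundaryFun d x) := rfl

theorem cubeCutoff_nonneg (m : ℕ) (x : d → unitInterval) : 0 ≤ cubeCutoff d m x :=
  le_min zero_le_one (mul_nonneg (Nat.cast_nonneg _) (boundaryFun_nonneg x))

theorem cubeCutoff_le_one (m : ℕ) (x : d → unitInterval) : cubeCutoff d m x ≤ 1 :=
  min_le_left _ _

/-- In a coordinate where x and y differ both have an endpoint, which kills both products. Hence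
every function vanishing on the boundary descends to the torus. -/
theorem eq_or_boundaryFun_eq_zero {x y : d → unitInterval}
    (h : cubeToTorus d x = cubeToTorus d y) :
    x = y ∨ (boundaryFun d x = 0 ∧ boundaryFun d y = 0) := by
  by_cases hxy : x = y
  · exact Or.inl hxy
  right
  obtain ⟨i, hi⟩ := Function.ne_iff.1 hxy
  obtain ⟨h1, h2⟩ :=
    (unitInterval.eq_or_of_coe_unitAddCircle_eq (congrFun h i)).resolve_left hi
  exact ⟨Finset.prod_eq_zero (Finset.mem_univ i) h1, Finset.prod_eq_zero (Finset.mem_univ i) h2⟩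

theorem ae_boundaryFun_ne_zero :
    ∀ᵐ x ∂(volume : Measure (d → unitInterval)), boundaryFun d x ≠ 0 := by
  have h : ∀ i (c : unitInterval), ∀ᵐ x ∂(volume : Measure (d → unitInterval)), x i ≠ c :=
    fun i c => by
      rw [ae_iff]
      simp only [ne_eq, not_not]
      exact Measure.pi_hyperplane (fun _ : d => (volume : Measure unitInterval)) i c
  filter_upwards [ae_all_iff.2 fun i => h i 0, ae_all_iff.2 fun i => h i 1] with x h0 h1
  refine Finset.prod_ne_zero_iff.2 fun i _ => mul_ne_zero ?_ (sub_ne_zero.2 ?_)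
  · exact fun e => h0 i (Subtype.ext e)
  · exact fun e => h1 i (Subtype.ext e.symm)

/-- Dominated convergence: at each interior point the cutoff equals 1 for large m, and the boundary
is null. -/
theorem tendsto_integral_one_sub_cubeCutoff :
    Tendsto (fun m => ∫ x, (1 - cubeCutoff d m x) ∂(volume : Measure (d → unitInterval)))
      atTop (𝓝 0) := by
  have h : Tendsto (fun m => ∫ x, (1 - cubeCutoff d m x) ∂(volume : Measure (d → unitInterval)))
      atTop (𝓝 (∫ _, (0 : ℝ) ∂(volume : Measure (d → unitInterval)))) := by
    refine tendsto_integral_of_dominated_convergence (fun _ => 1) (fun m => ?_)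
      (integrable_const _) (fun m => ae_of_all _ fun x => ?_) ?_
    · exact (continuous_const.sub (cubeCutoff d m).continuous).aestronglyMeasurable
    · rw [Real.norm_of_nonneg (sub_nonneg.2 (cubeCutoff_le_one m x))]
      linarith [cubeCutoff_nonneg m x]
    · filter_upwards [ae_boundaryFun_ne_zero (d := d)] with x hx
      have hpos : 0 < boundaryFun d x := lt_of_le_of_ne (boundaryFun_nonneg x) hx.symm
      refine tendsto_const_nhds.congr' ?_
      have ht : Tendsto (fun m : ℕ => (m : ℝ) * boundaryFun d x) atTop atTop :=
        tendsto_natCast_atTop_atTop.atTop_mul_const hpos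
      filter_upwards [ht.eventually_ge_atTop 1] with m hm
      rw [cubeCutoff_apply, min_eq_left hm, sub_self]
  simpa using h

end Cutoff

/-! ### Weyl's criterion on the torus and on the cube. -/

section Weyl

variable {d : Type*} [Fintype d]

theorem integrable_continuousMap_cube {E : Type*} [NormedAddCommGroup E] [SecondCountableTopology E]
    (f : C(d → unitInterval, E)) :
    Integrable f (volume : Measure (d → unitInterval)) :=
  Integrable.of_bound f.continuous.aestronglyMeasurable ‖f‖ (ae_of_all _ f.norm_coe_le_norm)

theorem integral_fourier_unitInterval {k : ℤ} (hk : k ≠ 0) :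
    ∫ x : unitInterval, fourier k (((x : ℝ)) : UnitAddCircle) = 0 := by
  have h0 : ∫ t : UnitAddCircle, fourier k t ∂AddCircle.haarAddCircle = 0 := by
    -- Translation by 1 / (2k) changes the sign of the k-th exponential.
    refine integral_eq_zero_of_add_right_eq_neg (g := ((1 / 2 / k : ℝ) : UnitAddCircle)) fun t => ?_
    have := fourier_add_half_inv_index (T := 1) hk one_pos t
    simpa using this
  rw [AddCircle.integral_haarAddCircle] at h0
  have h1 := UnitAddCircle.integral_preimage 0 (fun t => fourier k t)
  simp only [inv_one, one_smul] at h0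
  rw [h0, zero_add, ← integral_Icc_eq_integral_Ioc] at h1
  rw [← h1]
  exact integral_subtype measurableSet_Icc
    (fun x : ℝ => fourier k ((x : ℝ) : UnitAddCircle))

theorem integral_mFourier_cubeToTorus {k : d → ℤ} (hk : k ≠ 0) :
    ∫ x, UnitAddTorus.mFourier k (cubeToTorus d x) ∂(volume : Measure (d → unitInterval)) = 0 := by
  obtain ⟨i, hi⟩ := Function.ne_iff.1 hk
  simp only [UnitAddTorus.mFourier, ContinuousMap.coe_mk, cubeToTorus_apply]
  rw [integral_fintype_prod_volume_eq_prod
    (fun i (y : unitInterval) => fourier (k i) ((y : ℝ) : UnitAddCircle))]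
  exact Finset.prod_eq_zero (Finset.mem_univ i) (integral_fourier_unitInterval hi)

theorem norm_average_le {X : Type*} {g : X → ℂ} {C : ℝ} (hC : 0 ≤ C) (hg : ∀ x, ‖g x‖ ≤ C)
    (x : ℕ → X) (N : ℕ) : ‖(∑ n ∈ Finset.range N, g (x n)) / (N : ℂ)‖ ≤ C := by
  rw [norm_div, Complex.norm_natCast]
  refine div_le_of_le_mul₀ (Nat.cast_nonneg _) hC ?_
  calc _ ≤ ∑ n ∈ Finset.range N, C := norm_sum_le_of_le _ fun n _ => hg _
    _ = _ := by simp [mul_comm]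

/-- Weyl's criterion for continuous functions on the torus, pulled back to the cube. -/
theorem tendsto_average_torus {x : ℕ → d → unitInterval}
    (hx : ∀ k : d → ℤ, k ≠ 0 → Tendsto (fun N : ℕ =>
      (∑ n ∈ Finset.range N, UnitAddTorus.mFourier k (cubeToTorus d (x n))) / (N : ℂ))
      atTop (𝓝 0)) (F : C(UnitAddTorus d, ℂ)) :
    Tendsto (fun N : ℕ => (∑ n ∈ Finset.range N, F (cubeToTorus d (x n))) / (N : ℂ))
      atTop (𝓝 (∫ y, F (cubeToTorus d y) ∂(volume : Measure (d → unitInterval)))) := by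
  set P : C(UnitAddTorus d, ℂ) → Prop := fun F =>
    Tendsto (fun N : ℕ => (∑ n ∈ Finset.range N, F (cubeToTorus d (x n))) / (N : ℂ))
      atTop (𝓝 (∫ y, F (cubeToTorus d y) ∂(volume : Measure (d → unitInterval)))) with hP
  have hint : ∀ F : C(UnitAddTorus d, ℂ), Integrable (fun y => F (cubeToTorus d y))
      (volume : Measure (d → unitInterval)) := fun F =>
    integrable_continuousMap_cube (F.comp (cubeToTorus d))
  have hspan : ∀ G ∈ Submodule.span ℂ (Set.range (UnitAddTorus.mFourier (d := d))), P G := by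
    intro G hG
    induction hG using Submodule.span_induction with
    | mem G hG =>
      obtain ⟨k, rfl⟩ := hG
      by_cases hk : k = 0
      · subst hk
        simp only [hP, UnitAddTorus.mFourier_zero, ContinuousMap.one_apply]
        refine (tendsto_const_nhds (x := (1 : ℂ))).congr' ?_ |>.trans (by simp)
        -- At N = 0 the average is 0 / 0 = 0 rather than 1.
        filter_upwards [eventually_gt_atTop 0] with N hN
        have : (N : ℂ) ≠ 0 := by exact_mod_cast hN.ne'
        simp [this]
      · simp only [hP, integral_mFourier_cubeToTorus hk]
        exact hx k hk
    | zero => simp [hP]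
    | add G H _ _ hG hH =>
      simp only [hP, ContinuousMap.add_apply, Finset.sum_add_distrib, add_div]
      rw [integral_add (hint G) (hint H)]
      exact hG.add hH
    | smul c G _ hG =>
      simp only [hP, ContinuousMap.smul_apply, smul_eq_mul, ← Finset.mul_sum, mul_div_assoc]
      rw [integral_const_mul]
      exact hG.const_mul c
  -- Trigonometric polynomials are uniformly dense; an ε/3 argument then passes from them to F.
  have hF : F ∈ closure
      (Submodule.span ℂ (Set.range (UnitAddTorus.mFourier (d := d))) : Set C(UnitAddTorus d, ℂ)) := by
    have := UnitAddTorus.span_mFourier_closure_eq_top (d := d)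
    rw [← Submodule.topologicalClosure_coe, this]
    trivial
  rw [Metric.tendsto_atTop]
  intro ε hε
  obtain ⟨G, hG, hFG⟩ := Metric.mem_closure_iff.1 hF (ε / 3) (by positivity)
  obtain ⟨N₀, hN₀⟩ := Metric.tendsto_atTop.1 (hspan G hG) (ε / 3) (by positivity)
  refine ⟨N₀, fun N hN => ?_⟩
  have hN1 := hN₀ N hN
  have hle : ∀ y, ‖F y - G y‖ ≤ dist F G := fun y => by
    rw [← dist_eq_norm]
    exact ContinuousMap.dist_apply_le_dist y
  have h1 : ‖(∑ n ∈ Finset.range N, (F (cubeToTorus d (x n)) - G (cubeToTorus d (x n)))) / (N : ℂ)‖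
      ≤ dist F G := norm_average_le dist_nonneg hle (fun n => cubeToTorus d (x n)) N
  have h2 : ‖∫ y, (F (cubeToTorus d y) - G (cubeToTorus d y))
      ∂(volume : Measure (d → unitInterval))‖ ≤ dist F G := by
    simpa using norm_integral_le_of_norm_le_const
      (μ := (volume : Measure (d → unitInterval))) (ae_of_all _ fun y => hle (cubeToTorus d y))
  rw [Finset.sum_sub_distrib, sub_div] at h1
  rw [integral_sub (hint F) (hint G)] at h2
  rw [← dist_eq_norm] at h1 h2
  have t1 := dist_triangle4
    ((∑ n ∈ Finset.range N, F (cubeToTorus d (x n))) / (N : ℂ))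
    ((∑ n ∈ Finset.range N, G (cubeToTorus d (x n))) / (N : ℂ))
    (∫ y, G (cubeToTorus d y) ∂(volume : Measure (d → unitInterval)))
    (∫ y, F (cubeToTorus d y) ∂(volume : Measure (d → unitInterval)))
  rw [dist_comm (∫ y, G (cubeToTorus d y) ∂(volume : Measure (d → unitInterval)))] at t1
  linarith

/-- Convergence of averages for continuous functions on the cube that descend to the torus. -/
theorem tendsto_average_periodic {x : ℕ → d → unitInterval}
    (hx : ∀ k : d → ℤ, k ≠ 0 → Tendsto (fun N : ℕ =>
      (∑ n ∈ Finset.range N, UnitAddTorus.mFourier k (cubeToTorus d (x n))) / (N : ℂ))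
      atTop (𝓝 0)) (g : C(d → unitInterval, ℝ))
    (hg : ∀ y z, cubeToTorus d y = cubeToTorus d z → g y = g z) :
    Tendsto (fun N : ℕ => (∑ n ∈ Finset.range N, g (x n)) / (N : ℝ))
      atTop (𝓝 (∫ y, g y ∂(volume : Measure (d → unitInterval)))) := by
  set g' : C(d → unitInterval, ℂ) := ⟨fun y => (g y : ℂ), by fun_prop⟩
  set F : C(UnitAddTorus d, ℂ) := (isQuotientMap_cubeToTorus d).lift g' fun y z h => by
    simp [g', hg y z h]
  have hF : ∀ y, F (cubeToTorus d y) = (g y : ℂ) := fun y => by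
    have := (isQuotientMap_cubeToTorus d).lift_comp g' fun y z h => by simp [g', hg y z h]
    exact DFunLike.congr_fun this y
  have h := tendsto_average_torus hx F
  simp only [hF] at h
  rw [integral_complex_ofReal] at h
  have h2 := (Complex.continuous_re.tendsto _).comp h
  refine h2.congr fun N => ?_
  simp only [Function.comp]
  rw [← Complex.ofReal_sum, ← Complex.ofReal_natCast, ← Complex.ofReal_div, Complex.ofReal_re]

/-- Weyl's criterion on the unit cube. -/
theorem isEquidistributed_of_mFourier {x : ℕ → d → unitInterval}
    (hx : ∀ k : d → ℤ, k ≠ 0 → Tendsto (fun N : ℕ =>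
      (∑ n ∈ Finset.range N, UnitAddTorus.mFourier k (cubeToTorus d (x n))) / (N : ℂ))
      atTop (𝓝 0)) :
    IsEquidistributed (volume : Measure (d → unitInterval)) x := by
  intro f
  rw [Metric.tendsto_atTop]
  intro ε hε
  -- Split f = f·χ + f·u with χ the cutoff and u = 1 - χ. The first term is periodic. The second is
  -- at most ‖f‖ u, and u is periodic too (it is 1 on the boundary), so one choice of m makes both
  -- its integral and its eventual averages less than ε/4.
  have hlim := (tendsto_integral_one_sub_cubeCutoff (d := d)).const_mul ‖f‖
  rw [mul_zero] at hlim
  obtain ⟨m, hm⟩ := (hlim.eventually_lt_const (show 0 < ε / 4 by positivity)).exists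
  set u : C(d → unitInterval, ℝ) := 1 - cubeCutoff d m
  have hu_apply : ∀ y, u y = 1 - cubeCutoff d m y := fun y => rfl
  have hu0 : ∀ y, 0 ≤ u y := fun y => sub_nonneg.2 (cubeCutoff_le_one m y)
  have hz : ∀ y, boundaryFun d y = 0 → cubeCutoff d m y = 0 := fun y hy => by
    rw [cubeCutoff_apply, hy, mul_zero, min_eq_right zero_le_one]
  have hper1 := tendsto_average_periodic hx (f * cubeCutoff d m) fun y z h => by
    rcases eq_or_boundaryFun_eq_zero h with rfl | ⟨hy, hz'⟩
    · rfl
    · simp [hz y hy, hz z hz']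
  have hper2 := (tendsto_average_periodic hx u fun y z h => by
    rcases eq_or_boundaryFun_eq_zero h with rfl | ⟨hy, hz'⟩
    · rfl
    · simp [hu_apply, hz y hy, hz z hz']).const_mul ‖f‖
  simp only [hu_apply] at hper2
  obtain ⟨N₁, hN₁⟩ := Metric.tendsto_atTop.1 hper1 (ε / 4) (by positivity)
  obtain ⟨N₂, hN₂⟩ := eventually_atTop.1 (hper2.eventually_lt_const hm)
  refine ⟨max N₁ N₂, fun N hN => ?_⟩
  have b1 := hN₁ N (le_of_max_le_left hN)
  have b2 := hN₂ N (le_of_max_le_right hN)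
  have hpt : ∀ y, ‖f y * u y‖ ≤ ‖f‖ * u y := fun y => by
    rw [norm_mul, Real.norm_of_nonneg (hu0 y)]
    exact mul_le_mul_of_nonneg_right (f.norm_coe_le_norm y) (hu0 y)
  have hdec : ∀ y, f y = (f * cubeCutoff d m) y + f y * u y := fun y => by
    simp only [ContinuousMap.mul_apply, hu_apply]
    ring
  have e1 : (∑ n ∈ Finset.range N, f (x n)) / (N : ℝ)
      = (∑ n ∈ Finset.range N, (f * cubeCutoff d m) (x n)) / (N : ℝ)
        + (∑ n ∈ Finset.range N, f (x n) * u (x n)) / (N : ℝ) := by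
    rw [← add_div, ← Finset.sum_add_distrib]
    simp_rw [← hdec]
  have e2 : ∫ y, f y ∂(volume : Measure (d → unitInterval))
      = ∫ y, (f * cubeCutoff d m) y ∂(volume : Measure (d → unitInterval))
        + ∫ y, f y * u y ∂(volume : Measure (d → unitInterval)) := by
    exact (integral_congr_ae (ae_of_all _ hdec)).trans (integral_add
      (integrable_continuousMap_cube (f * cubeCutoff d m)) (integrable_continuousMap_cube (f * u)))
  have c1 : ‖(∑ n ∈ Finset.range N, f (x n) * u (x n)) / (N : ℝ)‖ < ε / 4 := by
    refine lt_of_le_of_lt ?_ b2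
    rw [norm_div, Real.norm_natCast, ← mul_div_assoc, Finset.mul_sum]
    gcongr
    exact norm_sum_le_of_le _ fun n _ => hpt (x n)
  have c2 : ‖∫ y, f y * u y ∂(volume : Measure (d → unitInterval))‖ < ε / 4 := by
    refine lt_of_le_of_lt ?_ hm
    rw [← integral_const_mul]
    exact norm_integral_le_of_norm_le
      ((integrable_continuousMap_cube u).const_mul ‖f‖) (ae_of_all _ hpt)
  rw [e1, e2]
  rw [Real.dist_eq] at b1 ⊢
  rw [Real.norm_eq_abs, abs_lt] at c1 c2
  rw [abs_lt] at b1 ⊢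
  constructor <;> linarith [b1.1, b1.2, c1.1, c1.2, c2.1, c2.2]

end Weyl

/-! ### From exponential sums in x_n to characters of ℤ_p. -/

namespace PadicInt

variable {p : ℕ} [Fact p.Prime]

/-- For `γ ≠ 0` the averages of `exp (2πi α γ / p ^ (n + 1))` tend to `0` for almost all `α`. -/
theorem ae_tendsto_average_levelChar {γ : ℤ_[p]} (hγ : γ ≠ 0) :
    ∀ᵐ α ∂(haar p), Tendsto (fun N : ℕ =>
      (∑ n ∈ Finset.range N, levelChar p (n + 1) (α * γ)) / (N : ℂ)) atTop (𝓝 0) := by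
  -- Orthogonality starts only at the valuation of γ, hence the shift, which is undone at the end.
  have h := ae_tendsto_average_of_orthogonal (μ := haar p)
    (f := fun n α => levelChar p (n + γ.valuation + 1) (α * γ))
    (fun n => ((continuous_levelChar _).comp (continuous_mul_const γ)).measurable)
    (fun n α => (norm_levelChar _ _).le)
    (fun m n hmn => integral_levelChar_mul_conj_eq_zero hγ (by omega) (by omega))
  filter_upwards [h] with α hα
  exact tendsto_average_of_tendsto_average_shift
    (a := fun n => levelChar p (n + 1) (α * γ)) (fun n => (norm_levelChar _ _).le) γ.valuation hα

/-- `toZModPow` is by definition the class of `appr`, and s_n is `appr (n + 1)`; hence the level n +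
1. -/
theorem coe_scaledPartialSum (n : ℕ) (x : ℤ_[p]) :
    (((scaledPartialSum n x : unitInterval) : ℝ) : UnitAddCircle)
      = ZMod.toAddCircle (toZModPow (n + 1) x) := by
  have h : toZModPow (n + 1) x = ((x.appr (n + 1) : ℕ) : ZMod (p ^ (n + 1))) := rfl
  have h' : ((scaledPartialSum n x : unitInterval) : ℝ)
      = (partialSum n x : ℝ) / (p : ℝ) ^ (n + 1) := rfl
  rw [h, ZMod.toAddCircle_natCast, h', partialSum_eq_appr, Nat.cast_pow]

/-- Additivity of the character merges the product over coordinates into one value at the integer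
combination. -/
theorem mFourier_scaledPartialSum {d : Type*} [Fintype d] (k : d → ℤ) (n : ℕ) (y : d → ℤ_[p]) :
    UnitAddTorus.mFourier k (cubeToTorus d fun i => scaledPartialSum n (y i))
      = levelChar p (n + 1) (∑ i, k i • y i) := by
  have h : ∀ i, fourier (k i) (cubeToTorus d (fun i => scaledPartialSum n (y i)) i)
      = levelChar p (n + 1) (k i • y i) := by
    intro i
    rw [cubeToTorus_apply, coe_scaledPartialSum, fourier_apply, levelChar_apply, map_zsmul,
      ZMod.stdAddChar_apply, ← map_zsmul]
    rfl
  simp only [UnitAddTorus.mFourier, ContinuousMap.coe_mk, h]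
  exact (map_prod (levelChar p (n + 1)).toMonoidHom
    (fun i => Multiplicative.ofAdd (k i • y i)) Finset.univ).symm

/-- An integer relation in ℤ_p becomes a rational one in ℚ_p. This is where independence of β
enters. -/
theorem sum_zsmul_ne_zero {d : Type*} [Fintype d] {β : d → ℤ_[p]}
    (hβ : LinearIndependent ℚ (fun i => (β i : ℚ_[p]))) {k : d → ℤ} (hk : k ≠ 0) :
    ∑ i, k i • β i ≠ 0 := by
  intro h
  have h' : ∑ i, (k i : ℚ) • (β i : ℚ_[p]) = 0 := by
    have := congrArg (Coe.ringHom (p := p)) h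
    simp only [map_sum, map_zsmul, map_zero] at this
    simp only [Int.cast_smul_eq_zsmul]
    exact this
  refine hk (funext fun i => ?_)
  have := Fintype.linearIndependent_iff.1 hβ _ h' i
  exact_mod_cast this

end PadicInt

theorem proposition1p3 (p : ℕ) [Fact p.Prime] (hp : p ≠ 2) (r : ℕ) (hr : 1 ≤ r)
    (β : Fin r → ℤ_[p]) (hβ : LinearIndependent ℚ (fun i => (β i : ℚ_[p]))) :
    ∀ᵐ α ∂(PadicInt.haar p), α ∈ equidistributedSet β := by
  have h : ∀ᵐ α ∂(PadicInt.haar p), ∀ k : Fin r → ℤ, k ≠ 0 → Tendsto (fun N : ℕ =>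
      (∑ n ∈ Finset.range N, PadicInt.levelChar p (n + 1) (α * ∑ i, k i • β i)) / (N : ℂ))
      atTop (𝓝 0) := by
    -- The exceptional null set depends on k, but `Fin r → ℤ` is countable.
    refine ae_all_iff.2 fun k => ?_
    by_cases hk : k = 0
    · exact ae_of_all _ fun α h => absurd hk h
    · filter_upwards [PadicInt.ae_tendsto_average_levelChar (PadicInt.sum_zsmul_ne_zero hβ hk)]
        with α hα _ using hα
  filter_upwards [h] with α hα
  refine isEquidistributed_of_mFourier fun k hk => (hα k hk).congr fun N => ?_
  simp only [PadicInt.mFourier_scaledPartialSum, Finset.mul_sum, mul_smul_comm]
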